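/- By a graph we mean a finite connected multigraph without loop edges (multiple edges are allowed), and its genus is $g(G)=|E(G)|-|V(G)|+1$. An automorphism of $G$ is a pair of permutations, one of $V(G)$ and one of $E(G)$, preserving incidence. A morphism $\phi:G\to G'$ maps vertices to vertices, and maps each edge with endpoints $x,y$ either to an edge with endpoints $\phi(x),\phi(y)$ or to the vertex $\phi(x)=\phi(y)$. For a vertex $x$ let $x(1)$ be the subgraph consisting of $x$, its neighbours and the edges incident to $x$. The morphism $\phi$ is harmonic if for every $x\in V(G)$ the number $|\phi^{-1}(e')\cap x(1)|$ does not depend on the choice of the edge $e'$ of $G'$ incident to $\phi(x)$, and non-degenerate if $\phi(x(1))\neq\{\phi(x)\}$ for every $x\in V(G)$. For a group $\Delta$ of automorphisms of $G$, the quotient graph $G/\Delta$ has as vertices the $\Delta$-orbits of vertices, and as edges the $\Delta$-orbits of those edges whose endpoints lie in distinct $\Delta$-orbits; the quotient morphism $\phi_\Delta:G\to G/\Delta$ sends vertices and such edges to their orbits, and sends every other edge to the common orbit of its endpoints. A group $\Gamma\le\mathrm{Aut}(G)$ acts harmonically on $G$ if for every subgroup $\Delta\le\Gamma$ the quotient morphism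 $\phi_\Delta$ is harmonic and non-degenerate. **Theorem.** For every integer $g\ge 2$ the maximum $M(g)$ of the orders $|\Gamma|$ of groups $\Gamma$ acting harmonically on some graph of genus $g$ exists, and $4(g-1)\le M(g)\le 6(g-1)$. Moreover, for every $g\ge 2$ either $M(g)=4(g-1)$ or $M(g)=6(g-1)$, and each of these two equalities holds for infinitely many $g$. -/

import Mathlib

open scoped Graph

namespace Graph

variable {α β α' β' : Type*}

/-- The standing convention on graphs: a finite connected multigraph without loop edges.
Multiple edges between two vertices are allowed. -/
structure IsFiniteConnectedLoopless (G : Graph α β) : Prop where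
  finite_vertexSet : V(G).Finite
  finite_edgeSet : E(G).Finite
  loopless : G.Loopless
  connected : G.toSimpleGraph.Connected

/-- The genus (cyclomatic number) `|E(G)| - |V(G)| + 1` of a connected graph. -/
noncomputable def genus (G : Graph α β) : ℤ :=
  (E(G).ncard : ℤ) - (V(G).ncard : ℤ) + 1

/-! ### Morphisms -/

/-- A morphism of graphs: vertices go to vertices, and an edge with ends `x`, `y` goes either to an
edge with ends `φ x`, `φ y`, or to the vertex `φ x = φ y` (a vertical edge). -/
structure Morphism (G : Graph α β) (G' : Graph α' β') where
  onVertex : V(G) → V(G')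
  onEdge : E(G) → V(G') ⊕ E(G')
  onEdge_spec : ∀ (e : E(G)) (x y : V(G)), G.IsLink e x y →
    (∃ e' : E(G'), onEdge e = Sum.inr e' ∧ G'.IsLink e' (onVertex x) (onVertex y)) ∨
    (onEdge e = Sum.inl (onVertex x) ∧ onEdge e = Sum.inl (onVertex y))

/-- The morphism as one function from `V(G) ∪ E(G)` to `V(G') ∪ E(G')`. -/
def Morphism.toFun {G : Graph α β} {G' : Graph α' β'} (φ : G.Morphism G') :
    V(G) ⊕ E(G) → V(G') ⊕ E(G') :=
  Sum.elim (fun x => Sum.inl (φ.onVertex x)) φ.onEdge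

/-- The smallest neighbourhood `x(1)` of a vertex `x`: its vertices are `x` and the vertices
adjacent to `x`, its edges are the edges incident to `x`. -/
def nbhd (G : Graph α β) (x : V(G)) : Set (V(G) ⊕ E(G)) :=
  Sum.inl '' {y : V(G) | y = x ∨ G.Adj x y} ∪ Sum.inr '' {e : E(G) | G.Inc e x}

/-- A morphism is non-degenerate if it contracts no neighbourhood `x(1)` to the vertex `φ x`. -/
def Morphism.IsNondegenerate {G : Graph α β} {G' : Graph α' β'} (φ : G.Morphism G') : Prop :=
  ∀ x : V(G), φ.toFun '' G.nbhd x ≠ {Sum.inl (φ.onVertex x)}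

/-- A morphism is harmonic if for every vertex `x` the number of edges in `x(1)` lying over an
edge `e'` incident to `φ x` does not depend on `e'`. -/
def Morphism.IsHarmonic {G : Graph α β} {G' : Graph α' β'} (φ : G.Morphism G') : Prop :=
  ∀ (x : V(G)) (e₁ e₂ : E(G')), G'.Inc e₁ (φ.onVertex x) → G'.Inc e₂ (φ.onVertex x) →
    (φ.toFun ⁻¹' {Sum.inr e₁} ∩ G.nbhd x).ncard = (φ.toFun ⁻¹' {Sum.inr e₂} ∩ G.nbhd x).ncard

/-! ### Automorphisms -/

/-- The automorphism group of a multigraph, as a group of pairs consisting of a permutation of the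
vertices and a permutation of the edges that together preserve incidence. -/
def autSubgroup (G : Graph α β) : Subgroup (Equiv.Perm V(G) × Equiv.Perm E(G)) where
  carrier := {σ | ∀ (e : E(G)) (x y : V(G)), G.IsLink (σ.2 e) (σ.1 x) (σ.1 y) ↔ G.IsLink e x y}
  mul_mem' := by
    intro σ τ hσ hτ e x y
    exact (hσ (τ.2 e) (τ.1 x) (τ.1 y)).trans (hτ e x y)
  one_mem' := fun _ _ _ => Iff.rfl
  inv_mem' := by
    intro σ hσ e x y
    have h := hσ (σ.2⁻¹ e) (σ.1⁻¹ x) (σ.1⁻¹ y)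
    simpa using h.symm

/-- The group `Aut(G)`. -/
abbrev Aut (G : Graph α β) : Type _ := G.autSubgroup

/-- `Aut(G)` acts on the vertices. -/
instance (G : Graph α β) : MulAction G.Aut V(G) :=
  MulAction.compHom V(G) ((MonoidHom.fst (Equiv.Perm V(G)) (Equiv.Perm E(G))).comp
    G.autSubgroup.subtype)

/-- `Aut(G)` acts on the edges. -/
instance (G : Graph α β) : MulAction G.Aut E(G) :=
  MulAction.compHom E(G) ((MonoidHom.snd (Equiv.Perm V(G)) (Equiv.Perm E(G))).comp
    G.autSubgroup.subtype)

theorem aut_isLink_iff {G : Graph α β} (σ : G.Aut) (e : E(G)) (x y : V(G)) :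
    G.IsLink (σ • e : E(G)) (σ • x : V(G)) (σ • y : V(G)) ↔ G.IsLink e x y :=
  σ.2 e x y

/-! ### Quotient graphs -/

section Quotient

variable {G : Graph α β} (Δ : Subgroup G.Aut)

/-- The vertex orbits of `Δ`. -/
abbrev VertexOrbit : Type _ := MulAction.orbitRel.Quotient Δ V(G)

/-- The edge orbits of `Δ`. -/
abbrev EdgeOrbit : Type _ := MulAction.orbitRel.Quotient Δ E(G)

/-- The orbit of a vertex. -/
def vertexOrbit (x : V(G)) : VertexOrbit Δ := Quotient.mk _ x

/-- The orbit of an edge. -/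
def edgeOrbit (e : E(G)) : EdgeOrbit Δ := Quotient.mk _ e

/-- An edge is vertical if its ends lie in the same orbit. -/
def IsVertical (e : E(G)) : Prop :=
  ∃ x y : V(G), G.IsLink e x y ∧ vertexOrbit Δ x = vertexOrbit Δ y

theorem vertexOrbit_smul (σ : Δ) (x : V(G)) : vertexOrbit Δ (σ • x) = vertexOrbit Δ x :=
  Quotient.sound (s := MulAction.orbitRel Δ V(G)) ⟨σ, rfl⟩

theorem exists_smul_eq_of_edgeOrbit_eq {e f : E(G)} (h : edgeOrbit Δ e = edgeOrbit Δ f) :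
    ∃ σ : Δ, σ • f = e :=
  Quotient.exact (s := MulAction.orbitRel Δ E(G)) h

/-- Two edges in one orbit have the same pair of end orbits. -/
theorem vertexOrbit_eq_or_eq {e f : E(G)} {x y u v : V(G)} (h : edgeOrbit Δ e = edgeOrbit Δ f)
    (he : G.IsLink e x y) (hf : G.IsLink f u v) :
    (vertexOrbit Δ x = vertexOrbit Δ u ∧ vertexOrbit Δ y = vertexOrbit Δ v) ∨
    (vertexOrbit Δ x = vertexOrbit Δ v ∧ vertexOrbit Δ y = vertexOrbit Δ u) := by
  obtain ⟨σ, rfl⟩ := exists_smul_eq_of_edgeOrbit_eq Δ h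
  have hf' := (aut_isLink_iff (σ : G.Aut) f u v).2 hf
  rcases he.eq_and_eq_or_eq_and_eq hf' with ⟨h1, h2⟩ | ⟨h1, h2⟩
  · obtain rfl := Subtype.ext h1
    obtain rfl := Subtype.ext h2
    exact Or.inl ⟨vertexOrbit_smul Δ σ u, vertexOrbit_smul Δ σ v⟩
  · obtain rfl := Subtype.ext h1
    obtain rfl := Subtype.ext h2
    exact Or.inr ⟨vertexOrbit_smul Δ σ v, vertexOrbit_smul Δ σ u⟩

/-- The quotient graph `G/Δ`: its vertices are the vertex orbits, its edges are the edge orbits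
other than the orbits of vertical edges, and incidence is inherited from `G`. -/
def quotientGraph : Graph (VertexOrbit Δ) (EdgeOrbit Δ) where
  vertexSet := Set.univ
  edgeSet := {a | ∃ e : E(G), edgeOrbit Δ e = a ∧ IsVertical Δ e}ᶜ
  IsLink a p q := p ≠ q ∧ ∃ (e : E(G)) (x y : V(G)), G.IsLink e x y ∧
    edgeOrbit Δ e = a ∧ vertexOrbit Δ x = p ∧ vertexOrbit Δ y = q
  isLink_symm := fun a _ =>
    ⟨fun _ _ ⟨hne, e, x, y, h, ha, hp, hq⟩ => ⟨hne.symm, e, y, x, h.symm, ha, hq, hp⟩⟩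
  eq_or_eq_of_isLink_of_isLink := by
    rintro a p q r s ⟨_, e, x, y, he, ha, rfl, rfl⟩ ⟨_, f, u, v, hf, hb, rfl, rfl⟩
    rcases vertexOrbit_eq_or_eq Δ (ha.trans hb.symm) he hf with h | h
    · exact Or.inl h.1
    · exact Or.inr h.1
  edge_mem_iff_exists_isLink := by
    intro a
    constructor
    · intro h
      obtain ⟨e, rfl⟩ : ∃ e, edgeOrbit Δ e = a := Quotient.exists_rep a
      obtain ⟨x, y, he⟩ := G.exists_isLink_of_mem_edgeSet e.2
      refine ⟨vertexOrbit Δ ⟨x, he.left_mem⟩, vertexOrbit Δ ⟨y, he.right_mem⟩, ?_,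
        e, ⟨x, he.left_mem⟩, ⟨y, he.right_mem⟩, he, rfl, rfl, rfl⟩
      intro hxy
      exact h ⟨e, rfl, ⟨x, he.left_mem⟩, ⟨y, he.right_mem⟩, he, hxy⟩
    · rintro ⟨p, q, hne, e, x, y, he, rfl, rfl, rfl⟩ ⟨f, hf, u, v, huv, h⟩
      rcases vertexOrbit_eq_or_eq Δ hf.symm he huv with h' | h'
      · exact hne (h'.1.trans (h.trans h'.2.symm))
      · exact hne (h'.1.trans (h.symm.trans h'.2.symm))
  left_mem_of_isLink := fun _ _ _ _ => Set.mem_univ _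

theorem edgeOrbit_mem {e : E(G)} (h : ¬ IsVertical Δ e) :
    edgeOrbit Δ e ∈ E(quotientGraph Δ) := by
  obtain ⟨x, y, he⟩ := G.exists_isLink_of_mem_edgeSet e.2
  exact ((quotientGraph Δ).edge_mem_iff_exists_isLink _).2
    ⟨vertexOrbit Δ ⟨x, he.left_mem⟩, vertexOrbit Δ ⟨y, he.right_mem⟩,
      fun hxy => h ⟨_, _, he, hxy⟩, e, ⟨x, he.left_mem⟩, ⟨y, he.right_mem⟩, he, rfl, rfl, rfl⟩

open Classical in
/-- The quotient morphism `G → G/Δ`: a vertex goes to its orbit, a non-vertical edge to its orbit,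
and a vertical edge to the common orbit of its ends. -/
noncomputable def quotientMap : G.Morphism (quotientGraph Δ) where
  onVertex x := ⟨vertexOrbit Δ x, Set.mem_univ _⟩
  onEdge e :=
    if h : IsVertical Δ e then Sum.inl ⟨vertexOrbit Δ h.choose, Set.mem_univ _⟩
    else Sum.inr ⟨edgeOrbit Δ e, edgeOrbit_mem Δ h⟩
  onEdge_spec := by
    intro e x y he
    by_cases h : IsVertical Δ e
    · right
      simp only [h, dif_pos, Sum.inl.injEq]
      obtain ⟨v, huv, heq⟩ := h.choose_spec
      rcases vertexOrbit_eq_or_eq Δ rfl huv he with h' | h'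
      · exact ⟨Subtype.ext h'.1, Subtype.ext (heq.trans h'.2)⟩
      · exact ⟨Subtype.ext (heq.trans h'.2), Subtype.ext h'.1⟩
    · left
      exact ⟨⟨edgeOrbit Δ e, edgeOrbit_mem Δ h⟩, by simp only [h, dif_neg, not_false_eq_true],
        fun hxy => h ⟨x, y, he, hxy⟩, e, x, y, he, rfl, rfl, rfl⟩

end Quotient

/-! ### Harmonic group actions -/

/-- A group `Γ` of automorphisms of `G` acts harmonically if for every subgroup `Δ` of `Γ` the
quotient morphism `G → G/Δ` is harmonic and non-degenerate. -/
def ActsHarmonically {G : Graph α β} (Γ : Subgroup G.Aut) : Prop :=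
  ∀ Δ : Subgroup G.Aut, Δ ≤ Γ → (quotientMap Δ).IsHarmonic ∧ (quotientMap Δ).IsNondegenerate

/-- The orders of the groups acting harmonically on some graph of genus `g`. Graphs being finite,
it is enough to let vertices and edges range over types in the lowest universe. -/
def harmonicOrders (g : ℕ) : Set ℕ :=
  {n | ∃ (α β : Type) (G : Graph α β) (Γ : Subgroup G.Aut),
    G.IsFiniteConnectedLoopless ∧ G.genus = g ∧ ActsHarmonically Γ ∧ Nat.card Γ = n}

/-- `M(g)`, the maximal order of a group acting harmonically on a graph of genus `g`. -/
noncomputable def maxHarmonicOrder (g : ℕ) : ℕ := sSup (harmonicOrders g)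

end Graph

/-!
The argument has the shape of the Hurwitz bound for Riemann surfaces. If `Γ` acts harmonically on
`G`, then an element of `Γ` fixing a vertex and an edge at it is the identity: the quotient by the
cyclic group it generates has a fibre with one edge there, harmonicity forces it to fix all edges at
the vertex, and connectedness does the rest (`ActsHarmonically.eq_one_of_smul_eq`). So `Γ` acts
freely on the darts (oriented edges) of `G`. Choose representatives of the vertex orbits along a
spanning tree of the quotient (`DartAction.exists_isPartialTree`), let `r_v` be the orders of their
stabilizers, and let `k` be the number of dart orbits outside the tree. Counting vertices and darts
gives
`(g - 1) / |Γ| = ∑ (1 - 1 / r_v) - 1 + k / 2`.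
The least positive value of the right side is `1 / 6`, attained only when `k = 0` and the nontrivial
`r_v` are `2, 3`, or when `k = 1` and the only nontrivial `r_v` is `3`; all other positive values are
at least `1 / 4`. Hence `|Γ| = 6 (g - 1)` or `|Γ| ≤ 4 (g - 1)`. In the first case `Γ` is moreover
generated by elements `a`, `b` with `a ^ 2 = b ^ 3 = 1`: generators of the stabilizers, or, when
`k = 1`, of the stabilizer of order `3` together with an element flipping an edge
(`DartAction.card_eq_six_mul_and_exists_generators`).

Conversely, if subgroups `A` and `B` generate a finite group, the group acts harmonically on the
bipartite graph of cosets of `A` and `B` (`card_mem_harmonicOrders_of_sup_eq_top`). With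
`|A| = 4` and `|B| = 2` in a group of order `4 (g - 1)`, this gives the lower bound for each `g`
(`four_mul_mem_harmonicOrders`). With `|A| = 2` and `|B| = 3`, it gives the value `6 (g - 1)` for each
`g` such that some group of order `6 (g - 1)` is generated by elements of orders `2` and `3`; the
rotation groups of the hexagonal lattice modulo `N` supply infinitely many such `g`
(`exists_six_mul_mem_harmonicOrders`). Finally, for `g = p + 1` with `p > 6` a prime congruent to `2`
modulo `3`, there is no such group (`closure_ne_top_of_card_eq_six_mul_prime`), so the maximum is
`4 (g - 1)`, and by Dirichlet's theorem there are infinitely many such `p`.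
-/

namespace Graph

open MulAction

/-! ### Free actions on darts and spanning trees of their quotients -/

/-- An action of a group `Γ` on a connected graph with vertices `V` and darts (oriented edges) `D`
which is free on darts. A dart `d` starts at `base d`, and `rev d` is the same edge with the other
orientation. Connectedness is stated as: a nonempty set of vertices which is closed under passing
along darts is everything. An element of `Γ` may send `d` to `rev d`, flipping an edge. -/
structure DartAction (Γ V D : Type*) [Group Γ] [MulAction Γ V] [MulAction Γ D] where
  base : D → V
  rev : D → D
  base_smul : ∀ (γ : Γ) (d : D), base (γ • d) = γ • base d
  rev_smul : ∀ (γ : Γ) (d : D), rev (γ • d) = γ • rev d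
  rev_rev : ∀ d, rev (rev d) = d
  free : ∀ (γ : Γ) (d : D), γ • d = d → γ = 1
  connected : ∀ S : Set V, S.Nonempty → (∀ d, base d ∈ S → base (rev d) ∈ S) → S = Set.univ

theorem orbitClass_eq_iff {Γ X : Type*} [Group Γ] [MulAction Γ X] {x y : X} :
    (Quotient.mk'' x : orbitRel.Quotient Γ X) = Quotient.mk'' y ↔ ∃ γ : Γ, γ • y = x := by
  rw [Quotient.eq'', orbitRel_apply]; rfl

theorem orbitClass_smul {Γ X : Type*} [Group Γ] [MulAction Γ X] (γ : Γ) (x : X) :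
    (Quotient.mk'' (γ • x) : orbitRel.Quotient Γ X) = Quotient.mk'' x :=
  orbitClass_eq_iff.2 ⟨γ, rfl⟩

theorem card_eq_card_mul_card_orbits_of_free {Γ X : Type*} [Group Γ] [MulAction Γ X]
    [Finite Γ] [Finite X] (h : ∀ (γ : Γ) (x : X), γ • x = x → γ = 1) :
    Nat.card X = Nat.card Γ * Nat.card (orbitRel.Quotient Γ X) := by
  classical
  have := Fintype.ofFinite (orbitRel.Quotient Γ X)
  rw [Nat.card_congr (selfEquivSigmaOrbitsQuotientStabilizer Γ X), Nat.card_sigma,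
    Finset.sum_congr rfl (g := fun _ => Nat.card Γ), Finset.sum_const, smul_eq_mul, mul_comm,
    Finset.card_univ, Nat.card_eq_fintype_card (α := orbitRel.Quotient Γ X)]
  intro ω _
  have hs : stabilizer Γ ω.out = ⊥ := (Subgroup.eq_bot_iff_forall _).2 fun γ hγ => h γ _ hγ
  have := (stabilizer Γ ω.out).card_eq_card_quotient_mul_card_subgroup
  rw [this, hs]; simp

theorem card_eq_sum_div_card_stabilizer {Γ X : Type*} [Group Γ] [MulAction Γ X]
    [Finite Γ] [Finite X] [Fintype (orbitRel.Quotient Γ X)] (φ : orbitRel.Quotient Γ X → X)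
    (hφ : ∀ ω, Quotient.mk'' (φ ω) = ω) :
    (Nat.card X : ℚ) = ∑ ω, (Nat.card Γ : ℚ) / Nat.card (stabilizer Γ (φ ω)) := by
  classical
  rw [Nat.card_congr (selfEquivSigmaOrbitsQuotientStabilizer' Γ X hφ), Nat.card_sigma,
    Nat.cast_sum]
  refine Finset.sum_congr rfl fun ω _ => ?_
  have := (stabilizer Γ (φ ω)).card_eq_card_quotient_mul_card_subgroup
  have h0 : (Nat.card (stabilizer Γ (φ ω)) : ℚ) ≠ 0 := by exact_mod_cast Nat.card_pos.ne'
  rw [this, Nat.cast_mul, mul_div_cancel_right₀ _ h0]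

namespace DartAction

variable {Γ V D : Type*} [Group Γ] [MulAction Γ V] [MulAction Γ D]

/-- A pair `(T, U)` recording a tree in the quotient graph together with a lift of it: `T` is a set
of vertices in pairwise distinct orbits, and `U` is the set of the orbits of the darts of the tree,
two for each of its `|T| - 1` edges. The tree itself need not be embedded in `V`; all that is kept
of it is that a dart in `U` starting at a vertex `x` of `T` can be moved by the stabilizer of `x` so
as to end in `T`. -/
structure IsPartialTree (A : DartAction Γ V D) (T : Finset V)
    (U : Finset (orbitRel.Quotient Γ D)) : Prop where
  nonempty : T.Nonempty
  card_eq : U.card + 2 = 2 * T.card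
  smul_eq : ∀ x ∈ T, ∀ γ : Γ, γ • x ∈ T → γ • x = x
  rev_mem : ∀ d : D, Quotient.mk'' d ∈ U → Quotient.mk'' (A.rev d) ∈ U
  base_mem : ∀ d : D, Quotient.mk'' d ∈ U → ∃ γ : Γ, γ • A.base d ∈ T
  neighbour_mem : ∀ d : D, Quotient.mk'' d ∈ U → A.base d ∈ T →
    ∃ γ : Γ, γ • A.base d = A.base d ∧ γ • A.base (A.rev d) ∈ T

/-- As the graph is connected, a partial tree that misses an orbit of vertices can be enlarged by a
dart leaving the union of the orbits it meets. -/
theorem IsPartialTree.exists_insert {A : DartAction Γ V D} {T : Finset V}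
    {U : Finset (orbitRel.Quotient Γ D)} (h : A.IsPartialTree T U) {x : V}
    (hx : ∀ γ : Γ, γ • x ∉ T) :
    ∃ T' U', A.IsPartialTree T' U' ∧ T'.card = T.card + 1 := by
  classical
  obtain ⟨d, hd, hd'⟩ : ∃ d, A.base d ∈ T ∧ ∀ γ : Γ, γ • A.base (A.rev d) ∉ T := by
    by_contra! hcon
    have := A.connected {y | ∃ γ : Γ, γ • y ∈ T}
      (h.nonempty.imp fun y hy => ⟨1, by simpa using hy⟩) (by
        rintro d ⟨γ, hγ⟩
        rw [← A.base_smul] at hγ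
        obtain ⟨δ, hδ⟩ := hcon _ hγ
        rw [A.rev_smul, A.base_smul, smul_smul] at hδ
        exact ⟨_, hδ⟩)
    obtain ⟨γ, hγ⟩ : x ∈ {y | ∃ γ : Γ, γ • y ∈ T} := this ▸ Set.mem_univ x
    exact hx γ hγ
  set y := A.base (A.rev d) with hy
  have hyT : y ∉ T := by simpa using hd' 1
  have hrd : (Quotient.mk'' (A.rev d) : orbitRel.Quotient Γ D) ∉ U := fun hU => by
    obtain ⟨γ, hγ⟩ := h.base_mem _ hU
    exact hd' γ hγ
  have hdU : (Quotient.mk'' d : orbitRel.Quotient Γ D) ∉ U := fun hU => hrd (h.rev_mem _ hU)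
  have hne : (Quotient.mk'' d : orbitRel.Quotient Γ D) ≠ Quotient.mk'' (A.rev d) := fun he => by
    obtain ⟨γ, hγ⟩ := orbitClass_eq_iff.1 he
    apply hd' γ
    rw [hy, ← A.base_smul, hγ]; exact hd
  refine ⟨insert y T, insert (Quotient.mk'' d) (insert (Quotient.mk'' (A.rev d)) U),
    ⟨⟨y, by simp⟩, ?_, ?_, ?_, ?_, ?_⟩, Finset.card_insert_of_notMem hyT⟩
  · rw [Finset.card_insert_of_notMem, Finset.card_insert_of_notMem hrd,
      Finset.card_insert_of_notMem hyT]
    · have := h.card_eq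
      omega
    · simp [hne, hdU]
  · intro u hu γ hγ
    rw [Finset.mem_insert] at hu hγ
    rcases hu with rfl | hu
    · exact hγ.resolve_right (hd' γ)
    · refine hγ.elim (fun he => absurd hu ?_) (h.smul_eq u hu γ)
      rw [← inv_smul_eq_iff.2 he.symm]
      exact hd' _
  · intro e he
    simp only [Finset.mem_insert] at he ⊢
    rcases he with he | he | he
    · obtain ⟨γ, rfl⟩ := orbitClass_eq_iff.1 he
      right; left
      rw [A.rev_smul, orbitClass_smul]
    · obtain ⟨γ, rfl⟩ := orbitClass_eq_iff.1 he
      left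
      rw [A.rev_smul, orbitClass_smul, A.rev_rev]
    · exact Or.inr (Or.inr (h.rev_mem _ he))
  · intro e he
    simp only [Finset.mem_insert] at he ⊢
    rcases he with he | he | he
    · obtain ⟨γ, rfl⟩ := orbitClass_eq_iff.1 he
      exact ⟨γ⁻¹, by simp [A.base_smul, hd]⟩
    · obtain ⟨γ, rfl⟩ := orbitClass_eq_iff.1 he
      exact ⟨γ⁻¹, by simp [A.base_smul, hy]⟩
    · exact (h.base_mem _ he).imp fun γ hγ => Or.inr hγ
  · intro e he heT
    simp only [Finset.mem_insert] at he heT ⊢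
    rcases he with he | he | he
    · obtain ⟨γ, rfl⟩ := orbitClass_eq_iff.1 he
      rw [A.base_smul, A.rev_smul, A.base_smul] at *
      have hfix : γ • A.base d = A.base d := by
        refine heT.elim (fun h1 => absurd hd ?_) (h.smul_eq _ hd γ)
        rw [← inv_smul_eq_iff.2 h1.symm]
        exact hd' _
      refine ⟨γ⁻¹, ?_, Or.inl (by simp [hy])⟩
      rw [inv_smul_smul, hfix]
    · obtain ⟨γ, rfl⟩ := orbitClass_eq_iff.1 he
      rw [A.base_smul, A.rev_smul, A.base_smul, A.rev_rev] at *
      have hfix : γ • y = y := heT.resolve_right (hd' γ)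
      refine ⟨γ⁻¹, ?_, Or.inr (by simpa using hd)⟩
      rw [inv_smul_smul, ← hy, hfix]
    · rcases heT with heT | heT
      · obtain ⟨γ, hγ⟩ := h.base_mem _ he
        exact absurd (heT ▸ hγ) (hd' γ)
      · obtain ⟨γ, h1, h2⟩ := h.neighbour_mem _ he heT
        exact ⟨γ, h1, Or.inr h2⟩

theorem exists_isPartialTree [Finite V] [Nonempty V] (A : DartAction Γ V D) :
    ∃ T U, A.IsPartialTree T U ∧ ∀ x : V, ∃ γ : Γ, γ • x ∈ T := by
  classical
  have := Fintype.ofFinite V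
  by_contra! hcon
  have key : ∀ n : ℕ, ∃ T U, A.IsPartialTree T U ∧ n < T.card := by
    intro n
    induction n with
    | zero =>
      obtain ⟨x⟩ := ‹Nonempty V›
      exact ⟨{x}, ∅, ⟨⟨x, by simp⟩, by simp, by simp, by simp, by simp, by simp⟩, by simp⟩
    | succ n ih =>
      obtain ⟨T, U, h, hn⟩ := ih
      obtain ⟨x, hx⟩ := hcon T U h
      obtain ⟨T', U', h', hT'⟩ := h.exists_insert hx
      exact ⟨T', U', h', by omega⟩
  obtain ⟨T, U, -, h⟩ := key (Fintype.card V)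
  exact absurd (Finset.card_le_univ T) (by omega)

/-- If a subgroup `H` contains the stabilizers of the vertices of `T`, and all neighbours of `T` lie
in `H • T`, then `H • T` is closed under adjacency, whence `H • T = V` and `H = Γ`. -/
theorem eq_top_of_forall_neighbour (A : DartAction Γ V D) {T : Set V} (hne : T.Nonempty)
    (hT : ∀ x ∈ T, ∀ γ : Γ, γ • x ∈ T → γ • x = x) (H : Subgroup Γ)
    (hstab : ∀ x ∈ T, stabilizer Γ x ≤ H)
    (hH : ∀ d, A.base d ∈ T → ∃ γ ∈ H, γ • A.base (A.rev d) ∈ T) : H = ⊤ := by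
  have huniv := A.connected {y | ∃ γ ∈ H, γ • y ∈ T}
    (hne.imp fun y hy => ⟨1, one_mem _, by simpa using hy⟩) (by
      rintro d ⟨γ, hγH, hγ⟩
      rw [← A.base_smul] at hγ
      obtain ⟨δ, hδH, hδ⟩ := hH _ hγ
      rw [A.rev_smul, A.base_smul, smul_smul] at hδ
      exact ⟨_, mul_mem hδH hγH, hδ⟩)
  obtain ⟨x, hx⟩ := hne
  refine (Subgroup.eq_top_iff' _).2 fun γ => ?_
  obtain ⟨δ, hδ, hδx⟩ : γ • x ∈ {y | ∃ γ ∈ H, γ • y ∈ T} := huniv ▸ Set.mem_univ _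
  rw [smul_smul] at hδx
  have := hstab x hx (hT x hx _ hδx : _ ∈ stabilizer Γ x)
  simpa using mul_mem (inv_mem hδ) this

end DartAction

/-! ### The genus bound for actions free on darts -/

/-- The numerical core of the genus bound. Here `r` lists the orders of the vertex stabilizers, `k`
counts the dart orbits outside a spanning tree of the quotient, and `q` is `(g - 1) / |Γ|`. Only
the stabilizer orders `2, 3` with `k = 0`, and `3` with `k = 1`, give a value of `q` strictly
between `0` and `1 / 4`. -/
theorem eq_one_div_six_of_lt_one_div_four {ι : Type*} [Fintype ι] (r : ι → ℕ)
    (hr : ∀ i, 0 < r i) (k : ℕ) (q : ℚ) (hq : q = ∑ i, (1 - 1 / (r i : ℚ)) - 1 + k / 2)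
    (h0 : 0 < q) (h4 : q < 1 / 4) :
    q = 1 / 6 ∧ ((k = 0 ∧ ∃ i j, r i = 2 ∧ r j = 3 ∧ ∀ l, l ≠ i → l ≠ j → r l = 1) ∨
      (k = 1 ∧ ∃ i, r i = 3 ∧ ∀ l, l ≠ i → r l = 1)) := by
  classical
  set S : Finset ι := Finset.univ.filter fun i => r i ≠ 1 with hS
  have hsum : ∑ i, (1 - 1 / (r i : ℚ)) = ∑ i ∈ S, (1 - 1 / (r i : ℚ)) := by
    refine (Finset.sum_subset (Finset.subset_univ _) fun i _ hi => ?_).symm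
    have : r i = 1 := by simpa [hS] using hi
    simp [this]
  rw [hsum] at hq
  have hpos : ∀ i, (0 : ℚ) < 1 / r i := fun i => by
    have : (0 : ℚ) < r i := by exact_mod_cast hr i
    positivity
  have hhalf : ∀ i ∈ S, 1 / (r i : ℚ) ≤ 1 / 2 := fun i hi => by
    have h1 : r i ≠ 1 := by simpa [hS] using hi
    have h2 : 2 ≤ r i := by have := hr i; omega
    have : (2 : ℚ) ≤ r i := by exact_mod_cast h2
    exact one_div_le_one_div_of_le (by norm_num) this
  have hlt : ∀ i, 1 / 4 < 1 / (r i : ℚ) → r i < 4 := fun i hi => by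
    have := lt_of_one_div_lt_one_div (by norm_num) hi
    exact_mod_cast this
  have hone : ∀ l, l ∉ S → r l = 1 := fun l hl => by simpa [hS] using hl
  have hcard : (S.card : ℚ) / 2 ≤ ∑ i ∈ S, (1 - 1 / (r i : ℚ)) := by
    have := Finset.card_nsmul_le_sum S (fun i => 1 - 1 / (r i : ℚ)) (1 / 2)
      fun i hi => by linarith [hhalf i hi]
    rw [nsmul_eq_mul] at this
    linarith
  have hkk : S.card + k < 3 := by
    have : (S.card : ℚ) + k < 3 := by linarith
    exact_mod_cast this
  have hcases : S.card = 0 ∨ S.card = 1 ∨ S.card = 2 := by omega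
  rcases hcases with h | h | h
  · rw [Finset.card_eq_zero] at h
    rw [h] at hq hkk
    have : k = 0 ∨ k = 1 ∨ k = 2 := by simp at hkk; omega
    exfalso
    rcases this with rfl | rfl | rfl <;> norm_num at hq <;> linarith
  · obtain ⟨i, hi⟩ := Finset.card_eq_one.1 h
    have hp := hpos i
    have hh := hhalf i (by simp [hi])
    rw [hi, Finset.sum_singleton] at hq
    have : k = 0 ∨ k = 1 := by omega
    rcases this with rfl | rfl
    · rw [Nat.cast_zero] at hq
      linarith
    · have h4' := hlt i (by push_cast at hq; linarith)
      have hne : r i ≠ 1 := by simpa [hS] using (hi ▸ Finset.mem_singleton_self i : i ∈ S)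
      have hri : r i = 3 := by
        have h2 : r i ≠ 2 := fun h2 => by rw [h2] at hq; norm_num at hq; linarith
        have := hr i
        omega
      refine ⟨by rw [hq, hri]; norm_num, Or.inr ⟨rfl, i, hri, fun l hl => hone l ?_⟩⟩
      simpa [hi] using hl
  · obtain ⟨i, j, hij, hi⟩ := Finset.card_eq_two.1 h
    obtain rfl : k = 0 := by omega
    have hhi := hhalf i (by simp [hi])
    have hhj := hhalf j (by simp [hi])
    rw [hi, Finset.sum_pair hij] at hq
    push_cast at hq
    have hi4 := hlt i (by linarith)
    have hj4 := hlt j (by linarith)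
    have hinS : ∀ l, l ∈ S → r l ≠ 1 := fun l hl => by simpa [hS] using hl
    have hi1 := hinS i (by simp [hi])
    have hj1 := hinS j (by simp [hi])
    have hi0 := hr i
    have hj0 := hr j
    have ci : r i = 2 ∨ r i = 3 := by omega
    have cj : r j = 2 ∨ r j = 3 := by omega
    have hrest : ∀ l, l ≠ i → l ≠ j → r l = 1 := fun l h1 h2 => hone l (by simp [hi, h1, h2])
    rcases ci with ci | ci <;> rcases cj with cj | cj <;> rw [ci, cj] at hq <;> norm_num at hq
    · exact absurd hq h0.ne'
    · exact ⟨hq, Or.inl ⟨rfl, i, j, ci, cj, hrest⟩⟩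
    · exact ⟨hq, Or.inl ⟨rfl, j, i, cj, ci, fun l h1 h2 => hrest l h2 h1⟩⟩
    · rw [hq] at h4; norm_num at h4

theorem exists_zpowers_eq_of_card_prime {Γ : Type*} [Group Γ] {p : ℕ} (hp : p.Prime)
    (K : Subgroup Γ) (hK : Nat.card K = p) : ∃ a : Γ, a ^ p = 1 ∧ Subgroup.zpowers a = K := by
  have := Fact.mk hp
  have := isCyclic_of_prime_card hK
  obtain ⟨a, ha⟩ := (Subgroup.isCyclic_iff_exists_zpowers_eq_top K).1 this
  refine ⟨a, ?_, ha⟩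
  have h : a ∈ K := ha ▸ Subgroup.mem_zpowers a
  have := pow_card_eq_one' (x := (⟨a, h⟩ : K))
  rw [hK] at this
  simpa using congrArg Subtype.val this

namespace DartAction

variable {Γ V D : Type*} [Group Γ] [MulAction Γ V] [MulAction Γ D]

/-- A group acting freely on the darts of a connected graph of genus `m + 1`, of order above `4 * m`,
has order `6 * m` and is generated by an element of order dividing `2` and one of order dividing
`3`. -/
theorem card_eq_six_mul_and_exists_generators [Finite Γ] [Finite V] [Nonempty V] [Finite D]
    (A : DartAction Γ V D) {m : ℕ} (hm : 0 < m) (hD : Nat.card D = 2 * Nat.card V + 2 * m)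
    (hΓ : 4 * m < Nat.card Γ) :
    Nat.card Γ = 6 * m ∧
      ∃ a b : Γ, a ^ 2 = 1 ∧ b ^ 3 = 1 ∧ Subgroup.closure {a, b} = ⊤ := by
  classical
  have := Fintype.ofFinite (orbitRel.Quotient Γ V)
  have := Fintype.ofFinite (orbitRel.Quotient Γ D)
  obtain ⟨T, U, hTU, hT⟩ := A.exists_isPartialTree
  have hex : ∀ ω : orbitRel.Quotient Γ V, ∃ x ∈ T, Quotient.mk'' x = ω := fun ω => by
    obtain ⟨x, rfl⟩ := Quotient.exists_rep ω
    obtain ⟨γ, hγ⟩ := hT x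
    exact ⟨_, hγ, orbitClass_smul γ x⟩
  choose φ hφT hφ using hex
  have hφmk : ∀ x ∈ T, φ (Quotient.mk'' x) = x := fun x hx => by
    obtain ⟨γ, hγ⟩ := orbitClass_eq_iff.1 (hφ (Quotient.mk'' x))
    rw [← hγ]
    exact hTU.smul_eq x hx γ (hγ ▸ hφT _)
  have hcardT : T.card = Fintype.card (orbitRel.Quotient Γ V) := by
    rw [← Finset.card_univ]
    exact Finset.card_bij' (fun x _ => Quotient.mk'' x) (fun ω _ => φ ω) (by simp)
      (fun ω _ => hφT ω) hφmk (fun ω _ => hφ ω)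
  have hU : U.card ≤ Fintype.card (orbitRel.Quotient Γ D) := Finset.card_le_univ U
  obtain ⟨k, hk⟩ := Nat.exists_eq_add_of_le hU
  have hcV := card_eq_sum_div_card_stabilizer φ hφ
  have hcD := card_eq_card_mul_card_orbits_of_free A.free
  set r : orbitRel.Quotient Γ V → ℕ := fun ω => Nat.card (stabilizer Γ (φ ω)) with hr
  have hN : (0 : ℚ) < Nat.card Γ := by exact_mod_cast Nat.card_pos
  have hq : (m : ℚ) / Nat.card Γ = ∑ ω, (1 - 1 / (r ω : ℚ)) - 1 + k / 2 := by
    have e1 : (Nat.card V : ℚ) = Nat.card Γ * ∑ ω, 1 / (r ω : ℚ) := by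
      rw [hcV, Finset.mul_sum]
      exact Finset.sum_congr rfl fun ω _ => by rw [hr]; ring
    have e2 : (Nat.card D : ℚ) = 2 * Nat.card V + 2 * m := by exact_mod_cast hD
    have e3 : (Nat.card D : ℚ) = Nat.card Γ * (2 * T.card - 2 + k) := by
      have : (U.card : ℚ) + 2 = 2 * T.card := by exact_mod_cast hTU.card_eq
      rw [hcD, Nat.card_eq_fintype_card (α := orbitRel.Quotient Γ D), hk]
      push_cast
      rw [← this]; ring
    rw [Finset.sum_sub_distrib, Finset.sum_const, Finset.card_univ, ← hcardT, nsmul_eq_mul,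
      mul_one, div_eq_iff hN.ne']
    linarith
  obtain ⟨h6, hcases⟩ := eq_one_div_six_of_lt_one_div_four r (fun ω => Nat.card_pos) k _ hq
    (by positivity) (by
      rw [div_lt_iff₀ hN]
      have : (4 * m : ℚ) < Nat.card Γ := by exact_mod_cast hΓ
      linarith)
  refine ⟨?_, ?_⟩
  · rw [div_eq_iff hN.ne'] at h6
    have : (Nat.card Γ : ℚ) = 6 * m := by linarith
    exact_mod_cast this
  have htriv : ∀ ω, r ω = 1 → ∀ H : Subgroup Γ, stabilizer Γ (φ ω) ≤ H := fun ω h H => by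
    rw [Subgroup.card_eq_one.1 h]; exact bot_le
  have hnb : ∀ H : Subgroup Γ, (∀ x ∈ T, stabilizer Γ x ≤ H) → ∀ d, Quotient.mk'' d ∈ U →
      A.base d ∈ T → ∃ γ ∈ H, γ • A.base (A.rev d) ∈ T := fun H hH d hd hdT => by
    obtain ⟨γ, h1, h2⟩ := hTU.neighbour_mem d hd hdT
    exact ⟨γ, hH _ hdT h1, h2⟩
  rcases hcases with ⟨rfl, i, j, hi, hj, hl⟩ | ⟨rfl, i, hi, hl⟩
  -- All darts lie over the tree, so `Γ` is generated by the vertex stabilizers.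
  · obtain ⟨a, ha, haK⟩ := exists_zpowers_eq_of_card_prime Nat.prime_two _ hi
    obtain ⟨b, hb, hbK⟩ := exists_zpowers_eq_of_card_prime Nat.prime_three _ hj
    have hUuniv : U = Finset.univ := Finset.eq_univ_of_card U hk.symm
    have hstab : ∀ x ∈ T, stabilizer Γ x ≤ Subgroup.closure {a, b} := fun x hx => by
      rw [← hφmk x hx]
      by_cases h1 : (Quotient.mk'' x : orbitRel.Quotient Γ V) = i
      · rw [h1, ← haK, Subgroup.zpowers_le]; exact Subgroup.subset_closure (by simp)
      by_cases h2 : (Quotient.mk'' x : orbitRel.Quotient Γ V) = j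
      · rw [h2, ← hbK, Subgroup.zpowers_le]; exact Subgroup.subset_closure (by simp)
      exact htriv _ (hl _ h1 h2) _
    exact ⟨a, b, ha, hb, A.eq_top_of_forall_neighbour hTU.nonempty hTU.smul_eq _ hstab
      fun d => hnb _ hstab d (by simp [hUuniv])⟩
  -- One dart orbit `c` lies outside the tree. It is closed under reversal, so some `a` flips a dart
  -- `d` in it, and `a ^ 2 = 1` by freeness.
  · obtain ⟨b, hb, hbK⟩ := exists_zpowers_eq_of_card_prime Nat.prime_three _ hi
    obtain ⟨c, hc⟩ : ∃ c, Uᶜ = {c} := Finset.card_eq_one.1 (by rw [Finset.card_compl]; omega)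
    have hmem : ∀ d : D, Quotient.mk'' d ∉ U → Quotient.mk'' d = c := fun d hd => by
      rw [← Finset.mem_compl, hc, Finset.mem_singleton] at hd; exact hd
    have hcU : c ∉ U := by rw [← Finset.mem_compl, hc]; simp
    obtain ⟨d, hdc, hdT⟩ : ∃ d : D, Quotient.mk'' d = c ∧ A.base d ∈ T := by
      obtain ⟨d, rfl⟩ := Quotient.exists_rep c
      obtain ⟨γ, hγ⟩ := hT (A.base d)
      exact ⟨γ • d, orbitClass_smul γ d, by rwa [A.base_smul]⟩
    have hrdc : Quotient.mk'' (A.rev d) = c := hmem _ fun h => hcU <| by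
      have := hTU.rev_mem _ h
      rwa [A.rev_rev, hdc] at this
    obtain ⟨a, ha⟩ := orbitClass_eq_iff.1 (hrdc.trans hdc.symm)
    have ha2 : a ^ 2 = 1 := A.free _ d (by
      rw [sq, mul_smul, ha, ← A.rev_smul, ha, A.rev_rev])
    have hstab : ∀ x ∈ T, stabilizer Γ x ≤ Subgroup.closure {a, b} := fun x hx => by
      rw [← hφmk x hx]
      by_cases h1 : (Quotient.mk'' x : orbitRel.Quotient Γ V) = i
      · rw [h1, ← hbK, Subgroup.zpowers_le]; exact Subgroup.subset_closure (by simp)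
      exact htriv _ (hl _ h1) _
    refine ⟨a, b, ha2, hb, A.eq_top_of_forall_neighbour hTU.nonempty hTU.smul_eq _ hstab
      fun e heT => ?_⟩
    by_cases he : Quotient.mk'' e ∈ U
    · exact hnb _ hstab e he heT
    · obtain ⟨γ, rfl⟩ := orbitClass_eq_iff.1 ((hmem e he).trans hdc.symm)
      rw [A.base_smul] at heT
      have hγ : γ ∈ Subgroup.closure {a, b} := hstab _ hdT (hTU.smul_eq _ hdT γ heT)
      refine ⟨(γ * a)⁻¹, inv_mem (mul_mem hγ (Subgroup.subset_closure (by simp))), ?_⟩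
      rw [A.rev_smul, A.base_smul, ← ha, A.base_smul, smul_smul γ a, inv_smul_smul]
      exact hdT

end DartAction

/-! ### Harmonic actions and freeness on darts -/

variable {α β : Type*} {G : Graph α β}

theorem IsFiniteConnectedLoopless.eq_univ_of_isLink_mem (hG : G.IsFiniteConnectedLoopless)
    {S : Set V(G)} (hS : S.Nonempty)
    (h : ∀ (e : E(G)) (x y : V(G)), G.IsLink e x y → x ∈ S → y ∈ S) : S = Set.univ := by
  obtain ⟨x, hx⟩ := hS
  refine Set.eq_univ_of_forall fun y => ?_
  have hr := (SimpleGraph.reachable_iff_reflTransGen x y).1 (hG.connected.preconnected x y)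
  induction hr with
  | refl => exact hx
  | tail _ hadj ih =>
    obtain ⟨e, he⟩ := hadj.2
    exact h ⟨e, he.edge_mem⟩ _ _ he ih

section Quotient

variable (Δ : Subgroup G.Aut)

theorem vertexOrbit_eq_iff {x y : V(G)} :
    vertexOrbit Δ x = vertexOrbit Δ y ↔ ∃ σ ∈ Δ, σ • y = x := by
  refine (orbitClass_eq_iff (Γ := Δ)).trans ?_
  exact ⟨fun ⟨σ, h⟩ => ⟨σ, σ.2, h⟩, fun ⟨σ, hσ, h⟩ => ⟨⟨σ, hσ⟩, h⟩⟩

theorem edgeOrbit_eq_iff {e f : E(G)} :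
    edgeOrbit Δ e = edgeOrbit Δ f ↔ ∃ σ ∈ Δ, σ • f = e := by
  refine (orbitClass_eq_iff (Γ := Δ)).trans ?_
  exact ⟨fun ⟨σ, h⟩ => ⟨σ, σ.2, h⟩, fun ⟨σ, hσ, h⟩ => ⟨⟨σ, hσ⟩, h⟩⟩

theorem quotientMap_toFun_eq_inr_iff (p : V(G) ⊕ E(G)) (c : E(quotientGraph Δ)) :
    (quotientMap Δ).toFun p = Sum.inr c ↔ ∃ e, p = Sum.inr e ∧ edgeOrbit Δ e = c := by
  classical
  rcases p with x | e
  · simp [Morphism.toFun]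
  · have hc : edgeOrbit Δ e = c → ¬ IsVertical Δ e := fun h hv => c.2 ⟨e, h, hv⟩
    by_cases hv : IsVertical Δ e
    · have : ¬ edgeOrbit Δ e = c := fun h => hc h hv
      simp [Morphism.toFun, quotientMap, hv, this]
    · simp [Morphism.toFun, quotientMap, hv, Subtype.ext_iff]

/-- The numbers compared in the definition of a harmonic morphism, as numbers of edges only. -/
theorem ncard_fibre (x : V(G)) (c : E(quotientGraph Δ)) :
    ((quotientMap Δ).toFun ⁻¹' {Sum.inr c} ∩ G.nbhd x).ncard =
      {e : E(G) | edgeOrbit Δ e = c ∧ G.Inc e x}.ncard := by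
  rw [← Set.ncard_image_of_injective {e : E(G) | edgeOrbit Δ e = c ∧ G.Inc e x}
    (Sum.inr_injective (α := V(G)))]
  refine congrArg Set.ncard (Set.ext fun p => ?_)
  simp only [Set.mem_inter_iff, Set.mem_preimage, Set.mem_singleton_iff,
    quotientMap_toFun_eq_inr_iff, Set.mem_image, Set.mem_ofPred_eq]
  constructor
  · rintro ⟨⟨e, rfl, he⟩, hx⟩
    refine ⟨e, ⟨he, ?_⟩, rfl⟩
    simpa [nbhd] using hx
  · rintro ⟨e, ⟨he, hx⟩, rfl⟩
    refine ⟨⟨e, rfl, he⟩, Or.inr ⟨e, hx, rfl⟩⟩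

end Quotient

theorem smul_inc_iff (σ : G.Aut) (e : E(G)) (x : V(G)) :
    G.Inc (σ • e : E(G)) (σ • x : V(G)) ↔ G.Inc e x := by
  constructor
  · rintro ⟨y, h⟩
    have h' : G.IsLink (σ • e : E(G)) (σ • x : V(G)) (σ • σ⁻¹ • ⟨y, h.right_mem⟩ : V(G)) := by
      rwa [smul_inv_smul]
    exact ((aut_isLink_iff σ e x _).1 h').inc_left
  · rintro ⟨y, h⟩
    exact ((aut_isLink_iff σ e x ⟨y, h.right_mem⟩).2 h).inc_left

theorem Aut.ext {σ τ : G.Aut} (hV : ∀ x : V(G), σ • x = τ • x) (hE : ∀ e : E(G), σ • e = τ • e) :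
    σ = τ :=
  Subtype.ext (Prod.ext (Equiv.ext hV) (Equiv.ext hE))

/-- If `σ` fixes the vertex `x` and one edge at `x`, then the quotient by the cyclic group generated
by `σ` has a fibre of size one at `x`, so by harmonicity all its fibres at `x` have size one. -/
theorem ActsHarmonically.smul_eq_of_inc (hG : G.IsFiniteConnectedLoopless) {Γ : Subgroup G.Aut}
    (hΓ : ActsHarmonically Γ) {σ : G.Aut} (hσ : σ ∈ Γ) {x : V(G)} (hx : σ • x = x)
    {e f : E(G)} (hex : G.Inc e x) (he : σ • e = e) (hfx : G.Inc f x) : σ • f = f := by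
  have := hG.loopless
  set Δ := Subgroup.zpowers σ
  have hΔx : ∀ δ ∈ Δ, δ • x = x := by
    rintro _ ⟨n, rfl⟩
    exact zpow_mem (K := stabilizer G.Aut x) hx n
  have hΔe : ∀ δ ∈ Δ, δ • e = e := by
    rintro _ ⟨n, rfl⟩
    exact zpow_mem (K := stabilizer G.Aut e) he n
  have hinc : ∀ f : E(G), G.Inc f x → ∃ c : E(quotientGraph Δ), edgeOrbit Δ f = c ∧
      (quotientGraph Δ).Inc c ((quotientMap Δ).onVertex x) := by
    rintro f ⟨z, hz⟩
    have hne : vertexOrbit Δ x ≠ vertexOrbit Δ ⟨z, hz.right_mem⟩ := fun h => by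
      obtain ⟨δ, hδ, h⟩ := (vertexOrbit_eq_iff Δ).1 h.symm
      rw [hΔx δ hδ] at h
      exact hz.ne (congrArg Subtype.val h)
    have hl : (quotientGraph Δ).IsLink (edgeOrbit Δ f) (vertexOrbit Δ x)
        (vertexOrbit Δ ⟨z, hz.right_mem⟩) := ⟨hne, f, x, ⟨z, hz.right_mem⟩, hz, rfl, rfl, rfl⟩
    exact ⟨⟨_, hl.edge_mem⟩, rfl, _, hl⟩
  obtain ⟨c, hc, hcx⟩ := hinc e hex
  obtain ⟨d, hd, hdx⟩ := hinc f hfx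
  have hcard := (hΓ Δ (by simpa [Δ] using hσ)).1 x c d hcx hdx
  rw [ncard_fibre, ncard_fibre] at hcard
  have hone : {e' : E(G) | edgeOrbit Δ e' = c ∧ G.Inc e' x} = {e} := by
    ext e'
    refine ⟨fun ⟨h, _⟩ => ?_, ?_⟩
    · obtain ⟨δ, hδ, h⟩ := (edgeOrbit_eq_iff Δ).1 (h.trans hc.symm)
      rw [← h, hΔe δ hδ]; rfl
    · rintro rfl
      exact ⟨hc, hex⟩
  rw [hone, Set.ncard_singleton] at hcard
  obtain ⟨f', hf'⟩ := Set.ncard_eq_one.1 hcard.symm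
  have h1 : f = f' := by
    have : f ∈ {e' : E(G) | edgeOrbit Δ e' = d ∧ G.Inc e' x} := ⟨hd, hfx⟩
    rwa [hf'] at this
  have h2 : σ • f = f' := by
    have : σ • f ∈ {e' : E(G) | edgeOrbit Δ e' = d ∧ G.Inc e' x} := by
      refine ⟨((edgeOrbit_eq_iff Δ).2 ⟨σ, Subgroup.mem_zpowers σ, rfl⟩).trans hd, ?_⟩
      have := (smul_inc_iff σ f x).2 hfx
      rwa [hx] at this
    rwa [hf'] at this
  rw [h2, h1]

theorem ActsHarmonically.eq_one_of_smul_eq (hG : G.IsFiniteConnectedLoopless)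
    {Γ : Subgroup G.Aut} (hΓ : ActsHarmonically Γ) {σ : G.Aut} (hσ : σ ∈ Γ) {x : V(G)}
    (hx : σ • x = x) {e : E(G)} (hex : G.Inc e x) (he : σ • e = e) : σ = 1 := by
  have huniv : {y : V(G) | σ • y = y ∧ ∃ f : E(G), G.Inc f y ∧ σ • f = f} = Set.univ := by
    refine hG.eq_univ_of_isLink_mem ⟨x, hx, e, hex, he⟩ ?_
    rintro f y z hf ⟨hy, f', hf', hff'⟩
    have hfix := hΓ.smul_eq_of_inc hG hσ hy hf' hff' hf.inc_left
    refine ⟨?_, f, hf.inc_right, hfix⟩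
    have h := (aut_isLink_iff σ f y z).2 hf
    rw [hfix, hy] at h
    exact Subtype.ext (h.right_unique hf)
  have hall := fun y => huniv ▸ Set.mem_univ y
  refine Aut.ext (fun y => (hall y).1) fun f => ?_
  obtain ⟨y, z, hf⟩ := G.exists_isLink_of_mem_edgeSet f.2
  obtain ⟨hy, f', hf', hff'⟩ := hall ⟨y, hf.left_mem⟩
  exact hΓ.smul_eq_of_inc hG hσ hy hf' hff' hf.inc_left

/-- A sufficient condition for a harmonic action: if the action is free on edges and no edge has both
ends in one orbit, then for `Δ ≤ Γ` the edges at `x` over a given edge of the quotient are a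
regular orbit of the stabilizer of `x` in `Δ`, so their number depends on `x` only. -/
theorem actsHarmonically_of_free {Γ : Subgroup G.Aut}
    (hfree : ∀ σ ∈ Γ, ∀ e : E(G), σ • e = e → σ = 1)
    (hlink : ∀ (e : E(G)) (x y : V(G)), G.IsLink e x y → ∀ σ ∈ Γ, σ • x ≠ y)
    (hinc : ∀ x : V(G), ∃ e : E(G), G.Inc e x) : ActsHarmonically Γ := by
  intro Δ hΔ
  have hvert : ∀ e : E(G), ¬ IsVertical Δ e := by
    rintro e ⟨x, y, he, hxy⟩
    obtain ⟨σ, hσ, h⟩ := (vertexOrbit_eq_iff Δ).1 hxy.symm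
    exact hlink e x y he σ (hΔ hσ) h
  constructor
  · have key : ∀ (x : V(G)) (c : E(quotientGraph Δ)),
        (quotientGraph Δ).Inc c ((quotientMap Δ).onVertex x) →
        ((quotientMap Δ).toFun ⁻¹' {Sum.inr c} ∩ G.nbhd x).ncard = Nat.card (stabilizer Δ x) := by
      rintro x c ⟨q, hne, e, u, v, he, hc, hu, -⟩
      obtain ⟨τ, hτ, rfl⟩ := (vertexOrbit_eq_iff Δ).1 hu
      have he' := (aut_isLink_iff τ⁻¹ e (τ • x) v).2 he
      rw [inv_smul_smul] at he'
      have hc' : edgeOrbit Δ (τ⁻¹ • e) = c :=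
        ((edgeOrbit_eq_iff Δ).2 ⟨τ⁻¹, inv_mem hτ, rfl⟩).trans hc
      set f := τ⁻¹ • e
      have hset : {e : E(G) | edgeOrbit Δ e = c ∧ G.Inc e x} =
          Set.range fun δ : stabilizer Δ x => ((δ : Δ) : G.Aut) • f := by
        ext e'
        constructor
        · rintro ⟨h1, h2⟩
          obtain ⟨δ, hδ, rfl⟩ := (edgeOrbit_eq_iff Δ).1 (h1.trans hc'.symm)
          refine ⟨⟨⟨δ, hδ⟩, ?_⟩, rfl⟩
          have h3 := (aut_isLink_iff δ f x (τ⁻¹ • v)).2 he'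
          rcases h2.eq_or_eq_of_isLink h3 with h | h
          · exact (Subtype.ext h).symm
          · exact absurd (Subtype.ext h).symm (hlink f _ _ he'.symm δ (hΔ hδ))
        · rintro ⟨δ, rfl⟩
          refine ⟨((edgeOrbit_eq_iff Δ).2 ⟨δ, δ.1.2, rfl⟩).trans hc', ?_⟩
          have h := (smul_inc_iff ((δ : Δ) : G.Aut) f x).2 he'.inc_left
          have hδ : ((δ : Δ) : G.Aut) • x = x := δ.2
          rwa [hδ] at h
      rw [ncard_fibre, hset, ← Nat.card_coe_set_eq]
      refine Nat.card_range_of_injective fun δ δ' h => Subtype.ext (Subtype.ext ?_)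
      have h' : (((δ' : Δ) : G.Aut)⁻¹ * ((δ : Δ) : G.Aut)) • f = f := by
        rw [mul_smul, inv_smul_eq_iff]; exact h
      exact (inv_mul_eq_one.1 (hfree _ (hΔ (mul_mem (inv_mem δ'.1.2) δ.1.2)) _ h')).symm
    exact fun x c d hc hd => (key x c hc).trans (key x d hd).symm
  · intro x h
    obtain ⟨e, he⟩ := hinc x
    have h1 := (quotientMap_toFun_eq_inr_iff Δ (Sum.inr e) ⟨_, edgeOrbit_mem Δ (hvert e)⟩).2
      ⟨e, rfl, rfl⟩
    have h2 : (quotientMap Δ).toFun (Sum.inr e) ∈ (quotientMap Δ).toFun '' G.nbhd x :=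
      ⟨_, Or.inr ⟨e, he, rfl⟩, rfl⟩
    rw [h, h1] at h2
    simp at h2

/-- The darts of a graph: the edges with a choice of one of the two orderings of the ends. A triple
`(e, x, y)` is the edge `e` oriented from `x` to `y`. -/
def Dart (G : Graph α β) : Type _ := {t : E(G) × V(G) × V(G) // G.IsLink t.1 t.2.1 t.2.2}

instance (G : Graph α β) : MulAction G.Aut G.Dart where
  smul σ t := ⟨(σ • t.1.1, σ • t.1.2.1, σ • t.1.2.2), (aut_isLink_iff σ _ _ _).2 t.2⟩
  one_smul _ := rfl
  mul_smul _ _ _ := rfl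

theorem IsFiniteConnectedLoopless.card_dart (hG : G.IsFiniteConnectedLoopless) :
    Nat.card G.Dart = 2 * E(G).ncard := by
  have := hG.loopless
  have hends : ∀ e : E(G), ∃ x y : V(G), G.IsLink e x y := fun e => by
    obtain ⟨x, y, h⟩ := G.exists_isLink_of_mem_edgeSet e.2
    exact ⟨⟨x, h.left_mem⟩, ⟨y, h.right_mem⟩, h⟩
  choose s t hst using hends
  have hbij : Function.Bijective (fun p : E(G) × Bool =>
      (bif p.2 then ⟨(p.1, s p.1, t p.1), hst p.1⟩ else ⟨(p.1, t p.1, s p.1), (hst p.1).symm⟩ :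
        G.Dart)) := by
    constructor
    · rintro ⟨e, b⟩ ⟨f, c⟩ h
      have hne : s e ≠ t e := fun h => (hst e).ne (congrArg Subtype.val h)
      have hef : e = f := by
        cases b <;> cases c <;> exact congrArg (fun t : G.Dart => t.1.1) h
      subst hef
      have hx := congrArg (fun t : G.Dart => t.1.2.1) h
      cases b <;> cases c
      · rfl
      · exact absurd hx.symm hne
      · exact absurd hx hne
      · rfl
    · rintro ⟨⟨e, x, y⟩, h⟩
      rcases h.eq_and_eq_or_eq_and_eq (hst e) with ⟨h1, h2⟩ | ⟨h1, h2⟩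
      · obtain rfl := Subtype.ext h1
        obtain rfl := Subtype.ext h2
        exact ⟨(e, true), rfl⟩
      · obtain rfl := Subtype.ext h1
        obtain rfl := Subtype.ext h2
        exact ⟨(e, false), rfl⟩
  rw [← Nat.card_congr (Equiv.ofBijective _ hbij), Nat.card_prod, Nat.card_coe_set_eq, mul_comm]
  simp

/-- A harmonic action is free on darts: an element fixing a dart is the identity. -/
def ActsHarmonically.dartAction (hG : G.IsFiniteConnectedLoopless) {Γ : Subgroup G.Aut}
    (hΓ : ActsHarmonically Γ) : DartAction Γ V(G) G.Dart where
  base t := t.1.2.1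
  rev t := ⟨(t.1.1, t.1.2.2, t.1.2.1), t.2.symm⟩
  base_smul _ _ := rfl
  rev_smul _ _ := rfl
  rev_rev _ := rfl
  free γ t h := by
    have h' : ((γ : G.Aut) • t.1.1, (γ : G.Aut) • t.1.2.1, (γ : G.Aut) • t.1.2.2) = t.1 :=
      congrArg Subtype.val h
    exact Subtype.ext (hΓ.eq_one_of_smul_eq hG γ.2 (congrArg (fun p => p.2.1) h') t.2.inc_left
      (congrArg (fun p => p.1) h'))
  connected _ hS h := hG.eq_univ_of_isLink_mem hS fun e x y he => h ⟨(e, x, y), he⟩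

theorem ActsHarmonically.card_eq_six_mul_and_exists_generators
    (hG : G.IsFiniteConnectedLoopless) {Γ : Subgroup G.Aut} (hΓ : ActsHarmonically Γ) {m : ℕ}
    (hm : 0 < m) (hg : G.genus = m + 1) (hcard : 4 * m < Nat.card Γ) :
    Nat.card Γ = 6 * m ∧ ∃ a b : Γ, a ^ 2 = 1 ∧ b ^ 3 = 1 ∧ Subgroup.closure {a, b} = ⊤ := by
  have := hG.finite_vertexSet.to_subtype
  have := hG.finite_edgeSet.to_subtype
  have := hG.connected.nonempty
  have : Finite G.Aut := inferInstance
  have : Finite Γ := inferInstance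
  have : Finite G.Dart := inferInstanceAs (Finite {t : E(G) × V(G) × V(G) // _})
  refine (hΓ.dartAction hG).card_eq_six_mul_and_exists_generators hm ?_ hcard
  rw [hG.card_dart, Nat.card_coe_set_eq]
  rw [genus] at hg
  omega

/-! ### Coset graphs -/

section CosetGraph

variable {K : Type*} [Group K] (A B : Subgroup K)

/-- The bipartite coset graph of two subgroups: the vertices are the left cosets of `A` and of `B`,
the edges are the elements of the group, and `k` joins `k A` to `k B`. -/
def cosetGraph : Graph ((K ⧸ A) ⊕ (K ⧸ B)) K where
  vertexSet := Set.univ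
  edgeSet := Set.univ
  IsLink k p q := (p = Sum.inl ↑k ∧ q = Sum.inr ↑k) ∨ (p = Sum.inr ↑k ∧ q = Sum.inl ↑k)
  isLink_symm := fun _ _ => ⟨fun _ _ h => h.elim (fun h => Or.inr ⟨h.2, h.1⟩)
    fun h => Or.inl ⟨h.2, h.1⟩⟩
  eq_or_eq_of_isLink_of_isLink := by
    rintro k p q r s (⟨rfl, rfl⟩ | ⟨rfl, rfl⟩) (⟨rfl, rfl⟩ | ⟨rfl, rfl⟩) <;> simp
  edge_mem_iff_exists_isLink := fun k => ⟨fun _ => ⟨_, _, Or.inl ⟨rfl, rfl⟩⟩, fun _ => Set.mem_univ _⟩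
  left_mem_of_isLink := fun _ _ _ _ => Set.mem_univ _

theorem cosetGraph_isLink (k : K) :
    (cosetGraph A B).IsLink k (Sum.inl ↑k) (Sum.inr ↑k) := Or.inl ⟨rfl, rfl⟩

/-- Moving from `x A` to `x a A = x A` is free, and moving from `x A` to `x b A` is possible through
the vertex `x B = x b B`, so the coset graph is connected as soon as `A` and `B` generate. -/
theorem cosetGraph_connected (h : A ⊔ B = ⊤) : (cosetGraph A B).toSimpleGraph.Connected := by
  set R := (cosetGraph A B).toSimpleGraph.Reachable
  let l : K → V(cosetGraph A B) := fun k => ⟨Sum.inl k, Set.mem_univ _⟩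
  let r : K → V(cosetGraph A B) := fun k => ⟨Sum.inr k, Set.mem_univ _⟩
  have hlr : ∀ k, R (l k) (r k) := fun k => SimpleGraph.Adj.reachable
    ⟨fun h => Sum.inl_ne_inr (congrArg Subtype.val h), k, cosetGraph_isLink A B k⟩
  have key : ∀ k ∈ Subgroup.closure ((A : Set K) ∪ B), ∀ x, R (l x) (l (x * k)) := by
    intro k hk
    induction hk using Subgroup.closure_induction with
    | mem k hk =>
      intro x
      rcases hk with hk | hk
      · have : l x = l (x * k) := Subtype.ext (congrArg Sum.inl
          (QuotientGroup.eq.2 (by simpa using hk)))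
        rw [← this]
      · have : r x = r (x * k) := Subtype.ext (congrArg Sum.inr
          (QuotientGroup.eq.2 (by simpa using hk)))
        have h1 := hlr x
        rw [this] at h1
        exact h1.trans (hlr _).symm
    | one => intro x; rw [mul_one]
    | mul k k' _ _ ih ih' => exact fun x => mul_assoc x k k' ▸ (ih x).trans (ih' _)
    | inv k _ ih => exact fun x => by simpa using (ih (x * k⁻¹)).symm
  rw [← Subgroup.sup_eq_closure, h] at key
  have hl : ∀ k, R (l 1) (l k) := fun k => by simpa using key k (Subgroup.mem_top k) 1
  have hall : ∀ v, R (l 1) v := by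
    rintro ⟨v | v, hv⟩
    · obtain ⟨k, rfl⟩ := QuotientGroup.mk_surjective v
      exact hl k
    · obtain ⟨k, rfl⟩ := QuotientGroup.mk_surjective v
      exact (hl k).trans (hlr k)
  have : Nonempty V(cosetGraph A B) := ⟨l 1⟩
  exact ⟨fun u v => (hall u).symm.trans (hall v)⟩

theorem cosetGraph_isFiniteConnectedLoopless [Finite K] (h : A ⊔ B = ⊤) :
    (cosetGraph A B).IsFiniteConnectedLoopless where
  finite_vertexSet := Set.toFinite _
  finite_edgeSet := Set.toFinite _
  loopless := ⟨by rintro e x (⟨rfl, h⟩ | ⟨rfl, h⟩) <;> simp at h⟩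
  connected := cosetGraph_connected A B h

theorem genus_cosetGraph [Finite K] :
    (cosetGraph A B).genus = Nat.card K - (A.index + B.index) + 1 := by
  have h1 : V(cosetGraph A B).ncard = A.index + B.index :=
    (Set.ncard_univ _).trans Nat.card_sum
  have h2 : E(cosetGraph A B).ncard = Nat.card K := Set.ncard_univ _
  rw [genus, h1, h2]
  push_cast
  rfl

/-- The action of a group on a coset graph by left multiplication. -/
def cosetGraphAut : K →* (cosetGraph A B).Aut :=
  (((Equiv.Set.univ _).symm.permCongrHom.toMonoidHom.comp
      (toPermHom K ((K ⧸ A) ⊕ (K ⧸ B)))).prod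
    ((Equiv.Set.univ K).symm.permCongrHom.toMonoidHom.comp (toPermHom K K))).codRestrict
      (cosetGraph A B).autSubgroup (by
    rintro k ⟨e, he⟩ ⟨x, hx⟩ ⟨y, hy⟩
    have hinl : ∀ z : (K ⧸ A) ⊕ (K ⧸ B), k • z = Sum.inl ↑(k * e) ↔ z = Sum.inl ↑e := fun z => by
      rw [← smul_left_cancel_iff k (x := z)]; rfl
    have hinr : ∀ z : (K ⧸ A) ⊕ (K ⧸ B), k • z = Sum.inr ↑(k * e) ↔ z = Sum.inr ↑e := fun z => by
      rw [← smul_left_cancel_iff k (x := z)]; rfl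
    exact or_congr (and_congr (hinl x) (hinr y)) (and_congr (hinr x) (hinl y)))

theorem cosetGraphAut_smul_vertex (k : K) (x : V(cosetGraph A B)) :
    (cosetGraphAut A B k • x : V(cosetGraph A B)) = k • (x : (K ⧸ A) ⊕ (K ⧸ B)) := rfl

theorem cosetGraphAut_smul_edge (k : K) (e : E(cosetGraph A B)) :
    (cosetGraphAut A B k • e : E(cosetGraph A B)) = k * (e : K) := rfl

theorem cosetGraphAut_injective : Function.Injective (cosetGraphAut A B) := by
  intro k k' h
  have := congrArg (fun σ : (cosetGraph A B).Aut =>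
    ((σ • (⟨1, Set.mem_univ _⟩ : E(cosetGraph A B)) : E(cosetGraph A B)) : K)) h
  simpa only [cosetGraphAut_smul_edge, mul_one] using this

theorem actsHarmonically_cosetGraphAut_range : ActsHarmonically (cosetGraphAut A B).range := by
  refine actsHarmonically_of_free ?_ ?_ ?_
  · rintro _ ⟨k, rfl⟩ e h
    have := congrArg Subtype.val h
    rw [cosetGraphAut_smul_edge, mul_eq_right] at this
    rw [this, map_one]
  · rintro e ⟨x, hx⟩ ⟨y, hy⟩ he _ ⟨k, rfl⟩ h
    have := congrArg Subtype.val h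
    rw [cosetGraphAut_smul_vertex] at this
    rcases he with ⟨rfl, rfl⟩ | ⟨rfl, rfl⟩ <;> cases this
  · rintro ⟨v | v, hv⟩
    · obtain ⟨k, rfl⟩ := QuotientGroup.mk_surjective v
      exact ⟨⟨k, Set.mem_univ _⟩, (cosetGraph_isLink A B k).inc_left⟩
    · obtain ⟨k, rfl⟩ := QuotientGroup.mk_surjective v
      exact ⟨⟨k, Set.mem_univ _⟩, (cosetGraph_isLink A B k).inc_right⟩

end CosetGraph

theorem card_mem_harmonicOrders_of_sup_eq_top {K : Type} [Group K] [Finite K] {A B : Subgroup K}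
    (h : A ⊔ B = ⊤) {g : ℕ} (hg : (Nat.card K : ℤ) - (A.index + B.index) + 1 = g) :
    Nat.card K ∈ harmonicOrders g :=
  ⟨_, _, cosetGraph A B, (cosetGraphAut A B).range, cosetGraph_isFiniteConnectedLoopless A B h,
    (genus_cosetGraph A B).trans hg, actsHarmonically_cosetGraphAut_range A B,
    Nat.card_congr (MonoidHom.ofInjective (cosetGraphAut_injective A B)).toEquiv.symm⟩

/-! ### Groups with given generators -/

theorem sup_zpowers_eq_top_of_closure_pair {K : Type*} [Group K] {a b : K}
    (h : Subgroup.closure {a, b} = ⊤) : Subgroup.zpowers a ⊔ Subgroup.zpowers b = ⊤ := by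
  rw [eq_top_iff, ← h, Subgroup.closure_le]
  rintro x (rfl | rfl)
  · exact Subgroup.mem_sup_left (Subgroup.mem_zpowers _)
  · exact Subgroup.mem_sup_right (Subgroup.mem_zpowers _)

/-- The product of a group of order `2` and the dihedral group of order `2 * m` is generated by a
Klein four-group and an involution; its coset graph has genus `4m - (m + 2m) + 1 = m + 1`. -/
theorem four_mul_mem_harmonicOrders {m : ℕ} (hm : 0 < m) : 4 * m ∈ harmonicOrders (m + 1) := by
  have : NeZero m := ⟨hm.ne'⟩
  let K := Multiplicative (ZMod 2) × DihedralGroup m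
  let A : Subgroup K := (⊤ : Subgroup (Multiplicative (ZMod 2))).prod
    (Subgroup.zpowers (DihedralGroup.sr 0))
  let B : Subgroup K := (⊥ : Subgroup (Multiplicative (ZMod 2))).prod
    (Subgroup.zpowers (DihedralGroup.sr 1))
  have h2 : Nat.card (Multiplicative (ZMod 2)) = 2 := by simp
  have hK : Nat.card K = 4 * m := by
    rw [Nat.card_prod, h2, DihedralGroup.nat_card]; ring
  have hA : Nat.card A = 4 := by
    rw [Nat.card_congr (Subgroup.prodEquiv _ _).toEquiv, Nat.card_prod, Nat.card_zpowers,
      DihedralGroup.orderOf_sr, Subgroup.card_top, h2]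
  have hB : Nat.card B = 2 := by
    rw [Nat.card_congr (Subgroup.prodEquiv _ _).toEquiv, Nat.card_prod, Nat.card_zpowers,
      DihedralGroup.orderOf_sr, Subgroup.card_bot]
  have hiA := A.card_mul_index
  have hiB := B.card_mul_index
  rw [hA, hK] at hiA
  rw [hB, hK] at hiB
  have htop : A ⊔ B = ⊤ := by
    set H : Subgroup (DihedralGroup m) :=
      (A ⊔ B).comap (MonoidHom.inr (Multiplicative (ZMod 2)) (DihedralGroup m))
    have h0 : DihedralGroup.sr 0 ∈ H :=
      Subgroup.mem_sup_left (Subgroup.mem_prod.2 ⟨one_mem _, Subgroup.mem_zpowers _⟩)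
    have h1 : DihedralGroup.sr 1 ∈ H :=
      Subgroup.mem_sup_right (Subgroup.mem_prod.2 ⟨one_mem _, Subgroup.mem_zpowers _⟩)
    have hr : ∀ i, DihedralGroup.r i ∈ H := fun i => by
      have h := pow_mem (mul_mem h0 h1) i.val
      rw [DihedralGroup.sr_mul_sr, DihedralGroup.r_pow] at h
      simpa using h
    have hH : ∀ d, d ∈ H := by
      rintro (i | i)
      · exact hr i
      · have h := mul_mem h0 (hr i)
        rwa [DihedralGroup.sr_mul_r, zero_add] at h
    refine (Subgroup.eq_top_iff' _).2 fun ⟨z, d⟩ => ?_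
    have hz : ((z, 1) : K) ∈ A ⊔ B :=
      Subgroup.mem_sup_left (Subgroup.mem_prod.2 ⟨Subgroup.mem_top _, one_mem _⟩)
    simpa using mul_mem hz (hH d : ((1, d) : K) ∈ A ⊔ B)
  rw [← hK]
  refine card_mem_harmonicOrders_of_sup_eq_top htop ?_
  rw [hK]
  push_cast
  omega

theorem card_mem_harmonicOrders_of_closure_eq_top {K : Type} [Group K] [Finite K] {a b : K}
    (ha : orderOf a = 2) (hb : orderOf b = 3) (h : Subgroup.closure {a, b} = ⊤) :
    ∃ m, 0 < m ∧ Nat.card K = 6 * m ∧ 6 * m ∈ harmonicOrders (m + 1) := by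
  have hdvd : 2 * 3 ∣ Nat.card K := Nat.Coprime.mul_dvd_of_dvd_of_dvd (by norm_num)
    (ha ▸ orderOf_dvd_natCard a) (hb ▸ orderOf_dvd_natCard b)
  obtain ⟨m, hm⟩ := hdvd
  have hpos : 0 < Nat.card K := Nat.card_pos
  refine ⟨m, by omega, by omega, ?_⟩
  have hiA := (Subgroup.zpowers a).card_mul_index
  have hiB := (Subgroup.zpowers b).card_mul_index
  rw [Nat.card_zpowers, ha] at hiA
  rw [Nat.card_zpowers, hb] at hiB
  have : 6 * m = Nat.card K := by omega
  rw [this]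
  refine card_mem_harmonicOrders_of_sup_eq_top (sup_zpowers_eq_top_of_closure_pair h) ?_
  push_cast
  omega

/-- The half-turn about `(1/2, 0)` of the hexagonal lattice `ℤ²`, reduced modulo `n`. -/
def halfTurn (n : ℕ) : Equiv.Perm (ZMod n × ZMod n) where
  toFun p := (1 - p.1, -p.2)
  invFun p := (1 - p.1, -p.2)
  left_inv p := by simp
  right_inv p := by simp

/-- The rotation of order three about the origin of the hexagonal lattice `ℤ²`, reduced
modulo `n`. -/
def thirdTurn (n : ℕ) : Equiv.Perm (ZMod n × ZMod n) where
  toFun p := (-p.2, p.1 - p.2)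
  invFun p := (p.2 - p.1, -p.1)
  left_inv p := by simp
  right_inv p := by simp

theorem orderOf_halfTurn {n : ℕ} (hn : 2 < n) : orderOf (halfTurn n) = 2 := by
  refine orderOf_eq_prime (Equiv.ext fun p => by simp [sq, halfTurn]) fun h => ?_
  have h0 := congrArg Prod.fst (Equiv.congr_fun h (0, 0))
  have : Fact (1 < n) := ⟨by omega⟩
  simp [halfTurn] at h0

theorem orderOf_thirdTurn {n : ℕ} (hn : 2 < n) : orderOf (thirdTurn n) = 3 := by
  have : Fact (1 < n) := ⟨by omega⟩
  refine orderOf_eq_prime (Equiv.ext fun p => by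
    simp only [pow_succ, pow_zero, one_mul, Equiv.Perm.mul_apply, Equiv.Perm.one_apply, thirdTurn,
      Equiv.coe_fn_mk]
    ext <;> ring) fun h => ?_
  have h0 := congrArg Prod.snd (Equiv.congr_fun h (1, 0))
  simp [thirdTurn] at h0

/-- The commutator of the two rotations is the translation by `(1, -1)`. As `halfTurn n` is its own
inverse, the commutator is written without inverting it. -/
theorem dvd_orderOf_commutator (n : ℕ) :
    n ∣ orderOf (halfTurn n * thirdTurn n * (halfTurn n * (thirdTurn n)⁻¹)) := by
  set c := halfTurn n * thirdTurn n * (halfTurn n * (thirdTurn n)⁻¹) with hc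
  have h1 : ∀ p, c p = (p.1 + 1, p.2 - 1) := fun p => by
    rw [hc]
    simp only [Equiv.Perm.mul_apply, Equiv.Perm.inv_def]
    simp only [halfTurn, thirdTurn, Equiv.coe_fn_mk, Equiv.coe_fn_symm_mk]
    ext <;> ring
  have h2 : ∀ k : ℕ, (c ^ k) (0, 0) = ((k : ZMod n), -(k : ZMod n)) := fun k => by
    induction k with
    | zero => simp
    | succ k ih =>
      rw [pow_succ', Equiv.Perm.mul_apply, ih, h1]
      ext <;> push_cast <;> ring
  have h3 := h2 (orderOf c)
  rw [pow_orderOf_eq_one] at h3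
  exact (ZMod.natCast_eq_zero_iff _ _).1 (congrArg Prod.fst h3).symm

theorem exists_six_mul_mem_harmonicOrders (n : ℕ) :
    ∃ m, n < m ∧ 6 * m ∈ harmonicOrders (m + 1) := by
  -- The group generated by the two rotations contains an element of order divisible by `N`, and its
  -- order is `6 * m`; so `N > 6 * n` forces `m > n`.
  set N := 6 * n + 6 with hN
  have : NeZero N := ⟨by omega⟩
  set K := Subgroup.closure {halfTurn N, thirdTurn N} with hK
  let a : K := ⟨halfTurn N, Subgroup.subset_closure (by simp)⟩
  let b : K := ⟨thirdTurn N, Subgroup.subset_closure (by simp)⟩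
  have htop : Subgroup.closure {a, b} = ⊤ := by
    have := Subgroup.closure_closure_coe_preimage (k := {halfTurn N, thirdTurn N})
    convert this using 2
    ext x
    simp [a, b, Subtype.ext_iff]
  obtain ⟨m, -, hm, hmem⟩ := card_mem_harmonicOrders_of_closure_eq_top (a := a) (b := b)
    ((Subgroup.orderOf_mk _ _).trans (orderOf_halfTurn (by omega)))
    ((Subgroup.orderOf_mk _ _).trans (orderOf_thirdTurn (by omega))) htop
  refine ⟨m, ?_, hmem⟩
  have hdvd : N ∣ Nat.card K := by
    refine (dvd_orderOf_commutator N).trans ?_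
    have := orderOf_dvd_natCard (a * b * (a * b⁻¹))
    rwa [← Subgroup.orderOf_coe] at this
  have := Nat.le_of_dvd Nat.card_pos hdvd
  omega

/-! ### A restriction on groups generated by elements of orders two and three -/

theorem card_le_six_of_normal_zpowers {Γ : Type*} [Group Γ] [Finite Γ] {a b : Γ} (ha : a ^ 2 = 1)
    (hb : b ^ 3 = 1) (h : Subgroup.closure {a, b} = ⊤) (hn : (Subgroup.zpowers b).Normal) :
    Nat.card Γ ≤ 6 := by
  have h1 := Subgroup.mul_normal (Subgroup.zpowers a) (Subgroup.zpowers b)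
  rw [sup_zpowers_eq_top_of_closure_pair h, Subgroup.coe_top] at h1
  have h2 := Set.natCard_mul_le (s := (Subgroup.zpowers a : Set Γ))
    (t := (Subgroup.zpowers b : Set Γ))
  rw [← h1, Nat.card_univ] at h2
  have ha' : Nat.card (Subgroup.zpowers a : Set Γ) ≤ 2 :=
    (Nat.card_zpowers a).trans_le (orderOf_le_of_pow_eq_one (by norm_num) ha)
  have hb' : Nat.card (Subgroup.zpowers b : Set Γ) ≤ 3 :=
    (Nat.card_zpowers b).trans_le (orderOf_le_of_pow_eq_one (by norm_num) hb)
  exact h2.trans (Nat.mul_le_mul ha' hb')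

/-- There is no group of order `6 * p` generated by elements `a`, `b` with `a ^ 2 = b ^ 3 = 1` when
`p > 6` is a prime congruent to `2` modulo `3`. The Sylow `p`-subgroup `P` is normal, and `b` acts
trivially on it since `3` does not divide `p - 1 = |Aut P|`. So the normalizer of the Sylow
`3`-subgroup generated by `b` has index at most `2`, hence index `1`, and `a`, `b` generate a group of
order at most `6`. -/
theorem closure_ne_top_of_card_eq_six_mul_prime {Γ : Type*} [Group Γ] [Finite Γ] {p : ℕ}
    (hp : p.Prime) (h6 : 6 < p) (hp3 : p % 3 = 2) (hcard : Nat.card Γ = 6 * p) {a b : Γ}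
    (ha : a ^ 2 = 1) (hb : b ^ 3 = 1) : Subgroup.closure {a, b} ≠ ⊤ := by
  intro htop
  have := Fact.mk hp
  have := Fact.mk Nat.prime_three
  suffices hn : (Subgroup.zpowers b).Normal by
    have := card_le_six_of_normal_zpowers ha hb htop hn
    omega
  have hp6 : ¬ p ∣ 6 := fun h => by have := Nat.le_of_dvd (by norm_num) h; omega
  let P : Sylow p Γ := default
  have hP : Nat.card P = p := by
    rw [P.card_eq_multiplicity, hcard, Nat.factorization_mul (by norm_num) hp.ne_zero,
      Finsupp.add_apply, hp.factorization_self, Nat.factorization_eq_zero_of_not_dvd hp6]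
    simp
  have hPn : (P : Subgroup Γ).Normal := by
    have h1 := (P : Subgroup Γ).card_mul_index
    rw [hcard, hP, mul_comm 6 p] at h1
    have h2 : (P : Subgroup Γ).index = 6 := Nat.eq_of_mul_eq_mul_left hp.pos h1
    have h3 := P.card_dvd_index
    rw [h2] at h3
    have h4 := Nat.le_of_dvd (by norm_num) h3
    have h5 : Nat.card (Sylow p Γ) % p = 1 % p := card_sylow_modEq_one p Γ
    rw [Nat.mod_eq_of_lt (by omega), Nat.mod_eq_of_lt (by omega)] at h5
    have := (Nat.card_eq_one_iff_unique.1 h5).1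
    exact P.normal_of_subsingleton
  have hcomm : ∀ x ∈ P, b * x * b⁻¹ = x := by
    have hcyc : IsCyclic P := isCyclic_of_prime_card hP
    have h1 : orderOf (MulAut.conjNormal (H := (P : Subgroup Γ)) b) ∣ 3 :=
      orderOf_dvd_of_pow_eq_one (by rw [← map_pow, hb, map_one])
    have h2 := orderOf_dvd_natCard (MulAut.conjNormal (H := (P : Subgroup Γ)) b)
    rw [IsCyclic.card_mulAut, hP, Nat.totient_prime hp] at h2
    have h3 : Nat.Coprime 3 (p - 1) := (Nat.Prime.coprime_iff_not_dvd Nat.prime_three).2 (by omega)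
    have h4 := orderOf_eq_one_iff.1 (Nat.eq_one_of_dvd_coprimes h3 h1 h2)
    intro x hx
    have := congrArg Subtype.val (DFunLike.congr_fun h4 (⟨x, hx⟩ : P))
    exact (MulAut.conjNormal_apply b (⟨x, hx⟩ : P)).symm.trans this
  by_cases hb1 : b = 1
  · rw [hb1, Subgroup.zpowers_one_eq_bot]; infer_instance
  have hord : orderOf b = 3 := orderOf_eq_prime hb hb1
  have hp3' : ¬ 3 ∣ p := by omega
  have hfac : (Nat.card Γ).factorization 3 = 1 := by
    rw [hcard, show 6 * p = 3 * (2 * p) by ring, Nat.factorization_mul (by norm_num)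
      (by have := hp.pos; omega), Finsupp.add_apply, Nat.prime_three.factorization_self,
      Nat.factorization_eq_zero_of_not_dvd (by omega)]
  let Q : Sylow 3 Γ := Sylow.ofCard (Subgroup.zpowers b) (by rw [Nat.card_zpowers, hord, hfac]; rfl)
  have hQ : (Q : Subgroup Γ) = Subgroup.zpowers b := Sylow.coe_ofCard _ _
  set M := Subgroup.normalizer ((Q : Subgroup Γ) : Set Γ) with hM
  have hQM : (Q : Subgroup Γ) ≤ M := Subgroup.le_normalizer
  have hPM : (P : Subgroup Γ) ≤ M := by
    intro x hx
    rw [hM, hQ]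
    have hxb : ∀ k : ℤ, x * b ^ k * x⁻¹ = b ^ k := fun k => by
      have : Commute b x := mul_inv_eq_iff_eq_mul.1 (hcomm x hx)
      rw [(this.zpow_left k).symm.eq, mul_inv_cancel_right]
    refine Subgroup.mem_normalizer_iff.2 fun y => ⟨?_, ?_⟩
    · rintro ⟨k, rfl⟩
      exact ⟨k, (hxb k).symm⟩
    · rintro ⟨k, hk⟩
      refine ⟨k, ?_⟩
      have h1 : x * y * x⁻¹ = x * b ^ k * x⁻¹ := hk.symm.trans (hxb k).symm
      exact (mul_left_cancel (mul_right_cancel h1)).symm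
  have hdvd : 3 * p ∣ Nat.card M := by
    refine Nat.Coprime.mul_dvd_of_dvd_of_dvd
      ((Nat.Prime.coprime_iff_not_dvd Nat.prime_three).2 hp3') ?_ ?_
    · have := Subgroup.card_dvd_of_le hQM
      rwa [hQ, Nat.card_zpowers, hord] at this
    · have := Subgroup.card_dvd_of_le hPM
      rwa [hP] at this
  have hidx : M.index ∣ 2 := by
    obtain ⟨t, ht⟩ := hdvd
    have h1 := M.card_mul_index
    rw [ht, hcard] at h1
    refine ⟨t, Nat.eq_of_mul_eq_mul_left (show 0 < 3 * p by have := hp.pos; omega) ?_⟩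
    rw [mul_comm M.index t, ← mul_assoc, h1]; ring
  have hmod : M.index % 3 = 1 := by
    have : M.index = Nat.card (Sylow 3 Γ) := Q.card_eq_index_normalizer.symm
    rw [this]
    exact card_sylow_modEq_one 3 Γ
  have hone : M.index = 1 := by
    have := Nat.le_of_dvd (by norm_num) hidx
    omega
  rw [← hQ]
  exact Subgroup.normalizer_eq_top_iff.1 (Subgroup.index_eq_one.1 hone)

/-! ### The maximal order -/

theorem isGreatest_maxHarmonicOrder {m : ℕ} (hm : 0 < m) :
    IsGreatest (harmonicOrders (m + 1)) (maxHarmonicOrder (m + 1)) ∧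
      (maxHarmonicOrder (m + 1) = 4 * m ∨ maxHarmonicOrder (m + 1) = 6 * m) := by
  have hle : ∀ n ∈ harmonicOrders (m + 1), n ≤ 4 * m ∨ n = 6 * m := by
    rintro _ ⟨α, β, G, Γ, hG, hg, hΓ, rfl⟩
    refine or_iff_not_imp_left.2 fun h => ?_
    exact (hΓ.card_eq_six_mul_and_exists_generators hG hm (by rw [hg]; push_cast; ring)
      (not_le.1 h)).1
  have h4 := four_mul_mem_harmonicOrders hm
  have hbdd : BddAbove (harmonicOrders (m + 1)) :=
    ⟨6 * m, fun n hn => by rcases hle n hn with h | h <;> omega⟩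
  have hmem : maxHarmonicOrder (m + 1) ∈ harmonicOrders (m + 1) := Nat.sSup_mem ⟨_, h4⟩ hbdd
  have hge : 4 * m ≤ maxHarmonicOrder (m + 1) := le_csSup hbdd h4
  exact ⟨⟨hmem, fun n hn => le_csSup hbdd hn⟩, (hle _ hmem).imp_left fun h => le_antisymm h hge⟩

theorem six_mul_prime_notMem_harmonicOrders {p : ℕ} (hp : p.Prime) (h6 : 6 < p)
    (hp3 : p % 3 = 2) : 6 * p ∉ harmonicOrders (p + 1) := by
  rintro ⟨α, β, G, Γ, hG, hg, hΓ, hcard⟩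
  have hpos : 0 < Nat.card Γ := by omega
  have : Finite Γ := Nat.finite_of_card_ne_zero hpos.ne'
  obtain ⟨-, a, b, ha, hb, htop⟩ := hΓ.card_eq_six_mul_and_exists_generators hG hp.pos
    (by rw [hg]; push_cast; ring) (by omega)
  exact closure_ne_top_of_card_eq_six_mul_prime hp h6 hp3 hcard ha hb htop

end Graph

theorem theorem1 :
    (∀ g : ℕ, 2 ≤ g →
      IsGreatest (Graph.harmonicOrders g) (Graph.maxHarmonicOrder g) ∧
      4 * (g - 1) ≤ Graph.maxHarmonicOrder g ∧ Graph.maxHarmonicOrder g ≤ 6 * (g - 1) ∧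
      (Graph.maxHarmonicOrder g = 4 * (g - 1) ∨ Graph.maxHarmonicOrder g = 6 * (g - 1))) ∧
    {g : ℕ | 2 ≤ g ∧ Graph.maxHarmonicOrder g = 4 * (g - 1)}.Infinite ∧
    {g : ℕ | 2 ≤ g ∧ Graph.maxHarmonicOrder g = 6 * (g - 1)}.Infinite := by
  refine ⟨fun g hg => ?_, ?_, ?_⟩
  · obtain ⟨m, rfl⟩ : ∃ m, g = m + 1 := ⟨g - 1, by omega⟩
    obtain ⟨h1, h2⟩ := Graph.isGreatest_maxHarmonicOrder (m := m) (by omega)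
    rw [Nat.add_sub_cancel]
    exact ⟨h1, by omega, by omega, h2⟩
  · refine Set.infinite_of_forall_exists_gt fun n => ?_
    obtain ⟨p, hpn, hp, hmod⟩ := Nat.forall_exists_prime_gt_and_modEq (n + 6) (q := 3) (a := 2)
      (by norm_num) (by norm_num)
    obtain ⟨h1, h2⟩ := Graph.isGreatest_maxHarmonicOrder hp.pos
    refine ⟨p + 1, ⟨by omega, ?_⟩, by omega⟩
    rw [Nat.add_sub_cancel]
    refine h2.resolve_right fun h => ?_
    exact Graph.six_mul_prime_notMem_harmonicOrders hp (by omega) hmod (h ▸ h1.1)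
  · refine Set.infinite_of_forall_exists_gt fun n => ?_
    obtain ⟨m, hnm, hmem⟩ := Graph.exists_six_mul_mem_harmonicOrders n
    obtain ⟨h1, h2⟩ := Graph.isGreatest_maxHarmonicOrder (m := m) (by omega)
    refine ⟨m + 1, ⟨by omega, ?_⟩, by omega⟩
    rw [Nat.add_sub_cancel]
    have := h1.2 hmem
    omega
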